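/- Let $G$ be a Lie group of dimension $n\ge 3$ with Lie algebra $\mathfrak g$ such that every left-invariant Riemannian metric on $G$ has non-positive scalar curvature. Let $I=[t_0,\infty)$, let $\gamma\in C^2(I,T^0_2\mathfrak g)$ be a family of Riemannian (left-invariant) metrics, and put $g=\gamma-dt\otimes dt$ on $M=G\times I$, $k=-\tfrac12\dot\gamma$, $H=-\mathrm{tr}_\gamma k/n$. Let $T=S-j\otimes dt-dt\otimes j+\rho\,dt\otimes dt$ with a function $\rho\in C^1(I)$, a covector $j\in C^1(I,T^0_1\mathfrak g)$ and a symmetric tensor $S\in C^1(I,T^0_2\mathfrak g)$ satisfying the energy conditions $|j|_\gamma\le\rho$, $|\mathrm{tr}_\gamma S|\le n\rho$ and $\rho+\mathrm{tr}_\gamma S\ge 0$. Let $J\subset\mathbb R$ be an interval with non-empty interior, $V,C\in C^1(J)$, $c\in C(J)$ and $\phi\in C^2(I,J)$, where $C\ge 0$ and $|c|\le C_0\,C$ on $J$ for some constant $C_0$, and where $V>0$ satisfies: - (P1) $V$ has a positive lower semi-continuous minorant defined on the closure of $J$ in $\mathbb R$; - (P2) $V'$ is bounded on every subset of $J$ on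 which $V$ is bounded; - (P3) $V'$ extends to a continuous $[-\infty,\infty]$-valued function on the closure of $J$ in $[-\infty,\infty]$. Suppose that the coupled Einstein-scalar field-matter equations $$Rc_g-\tfrac12R_g\,g=\nabla\phi\otimes\nabla\phi-\tfrac12|\nabla\phi|_g^2\,g-V(\phi)\,g+C(\phi)T,$$ $$\Box_g\phi-V'(\phi)=-c(\phi)\,\mathrm{tr}_gT,\qquad \mathrm{Div}_g\big(C(\phi)T\big)=c(\phi)(\mathrm{tr}_gT)\nabla\phi$$ hold on $M$, that $H(t_0)>0$, and that $V_0:=\inf_{t\in I}V(\phi(t))>0$. Put $H_0:=\sqrt{2V_0/(n(n-1))}$ and $q:=-1-\dot H/H^2$. Then, as $t\to\infty$: 1. $H(t)\to H_\infty$ for some real number $H_\infty\ge H_0>0$; 2. $V(\phi(t))\to V_\infty:=\tfrac12n(n-1)H_\infty^2>0$; 3. $V'(\phi(t))\to 0$; 4. $\dot\phi(t)\to 0$ and $\ddot\phi(t)\to 0$; 5. $q(t)\to-1$, that is, the expansion is asymptotically exponential. -/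

import Mathlib

open Set Filter Topology
open scoped Manifold ContDiff

noncomputable section

namespace CoupledQuintessence

/-! ### Pseudo-Riemannian geometry of a metric in a moving frame

The geometric objects below are the components, in a frame `(e_a)`, of the Levi-Civita connection,
the curvature, etc. of a metric `g` whose components `g_{ab} = g(e_a, e_b)` depend on one real
variable `t` only.  The data are

* `D a f`, the derivative `e_a f` of a function `f` of `t` along the frame field `e_a`;
* `c a b d`, the (constant) structure coefficients of the frame, `[e_a, e_b] = ∑_d c a b d • e_d`;
* `g t`, the matrix `g_{ab}` at `t`.
-/

section Frame

variable {ι : Type*} [Fintype ι] [DecidableEq ι]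

/-- The Koszul formula for the Levi-Civita connection, `g(∇_{e_a} e_b, e_d)`. -/
def koszul (D : ι → (ℝ → ℝ) → ℝ → ℝ) (c : ι → ι → ι → ℝ) (g : ℝ → Matrix ι ι ℝ)
    (a b d : ι) (t : ℝ) : ℝ :=
  (1 / 2) *
    (D a (fun s => g s b d) t + D b (fun s => g s a d) t - D d (fun s => g s a b) t
      + ∑ e, c a b e * g t e d - ∑ e, c a d e * g t e b - ∑ e, c b d e * g t e a)

/-- Connection coefficients: `∇_{e_a} e_b = ∑_d Γ a b d • e_d`. -/
def christoffel (D : ι → (ℝ → ℝ) → ℝ → ℝ) (c : ι → ι → ι → ℝ) (g : ℝ → Matrix ι ι ℝ)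
    (a b d : ι) (t : ℝ) : ℝ :=
  ∑ e, (g t)⁻¹ d e * koszul D c g a b e t

/-- Curvature components: `R(e_a, e_b) e_d = ∑_f (riemann a b d f) • e_f` with
`R(X, Y) = ∇_X ∇_Y - ∇_Y ∇_X - ∇_{[X, Y]}`. -/
def riemann (D : ι → (ℝ → ℝ) → ℝ → ℝ) (c : ι → ι → ι → ℝ) (g : ℝ → Matrix ι ι ℝ)
    (a b d f : ι) (t : ℝ) : ℝ :=
  D a (christoffel D c g b d f) t - D b (christoffel D c g a d f) t
    + ∑ e, (christoffel D c g b d e t * christoffel D c g a e f t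
        - christoffel D c g a d e t * christoffel D c g b e f t
        - c a b e * christoffel D c g e d f t)

/-- Ricci tensor: `Rc(e_b, e_d)` is the trace of `X ↦ R(X, e_b) e_d`. -/
def ricci (D : ι → (ℝ → ℝ) → ℝ → ℝ) (c : ι → ι → ι → ℝ) (g : ℝ → Matrix ι ι ℝ)
    (b d : ι) (t : ℝ) : ℝ :=
  ∑ a, riemann D c g a b d a t

/-- Trace of a covariant 2-tensor with respect to a metric. -/
def metricTrace (g A : Matrix ι ι ℝ) : ℝ := ∑ a, ∑ b, g⁻¹ a b * A a b

/-- Scalar curvature. -/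
def scalarCurv (D : ι → (ℝ → ℝ) → ℝ → ℝ) (c : ι → ι → ι → ℝ) (g : ℝ → Matrix ι ι ℝ)
    (t : ℝ) : ℝ :=
  metricTrace (g t) (Matrix.of fun a b => ricci D c g a b t)

/-- The squared length `|∇u|²_g` of the gradient of a function `u` of `t`. -/
def gradSq (D : ι → (ℝ → ℝ) → ℝ → ℝ) (g : ℝ → Matrix ι ι ℝ) (u : ℝ → ℝ) (t : ℝ) : ℝ :=
  metricTrace (g t) (Matrix.of fun a b => D a u t * D b u t)

/-- The covariant wave operator (trace of the Hessian) `□_g u`. -/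
def box (D : ι → (ℝ → ℝ) → ℝ → ℝ) (c : ι → ι → ι → ℝ) (g : ℝ → Matrix ι ι ℝ)
    (u : ℝ → ℝ) (t : ℝ) : ℝ :=
  metricTrace (g t) (Matrix.of fun a b =>
    D a (D b u) t - ∑ d, christoffel D c g a b d t * D d u t)

/-- Covariant derivative of a covariant 2-tensor: `(∇_{e_d} A)(e_a, e_b)`. -/
def covDeriv (D : ι → (ℝ → ℝ) → ℝ → ℝ) (c : ι → ι → ι → ℝ) (g : ℝ → Matrix ι ι ℝ)
    (A : ℝ → Matrix ι ι ℝ) (d a b : ι) (t : ℝ) : ℝ :=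
  D d (fun s => A s a b) t - ∑ e, christoffel D c g d a e t * A t e b
    - ∑ e, christoffel D c g d b e t * A t a e

/-- Divergence of a symmetric covariant 2-tensor, a covector. -/
def divergence (D : ι → (ℝ → ℝ) → ℝ → ℝ) (c : ι → ι → ι → ℝ) (g : ℝ → Matrix ι ι ℝ)
    (A : ℝ → Matrix ι ι ℝ) (b : ι) (t : ℝ) : ℝ :=
  metricTrace (g t) (Matrix.of fun d a => covDeriv D c g A d a b t)

end Frame

/-! ### Left-invariant tensors on a Lie group

Left-invariant tensors on a Lie group are identified with tensors on its Lie algebra `𝔤`. -/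

section LieAlg

variable {𝔤 : Type*} [LieRing 𝔤] [LieAlgebra ℝ 𝔤] {n : ℕ}

/-- Structure constants of a basis `(b_i)` of `𝔤`: `[b_i, b_j] = ∑_k C i j k • b_k`. -/
def structureConst (b : Module.Basis (Fin n) ℝ 𝔤) (i j k : Fin n) : ℝ := b.repr ⁅b i, b j⁆ k

/-- Components of a covariant 2-tensor on `𝔤`. -/
def components (b : Module.Basis (Fin n) ℝ 𝔤) (A : LinearMap.BilinForm ℝ 𝔤) :
    Matrix (Fin n) (Fin n) ℝ := Matrix.of fun i j => A (b i) (b j)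

/-- Euclidean inner products on `𝔤`, that is, left-invariant Riemannian metrics. -/
def IsMetric (A : LinearMap.BilinForm ℝ 𝔤) : Prop :=
  (∀ X Y, A X Y = A Y X) ∧ ∀ X, X ≠ 0 → 0 < A X X

/-- Scalar curvature of the left-invariant Riemannian metric `A`: invariant functions are constant,
so they have zero derivative along the left-invariant frame. -/
def leftInvScalarCurv (b : Module.Basis (Fin n) ℝ 𝔤) (A : LinearMap.BilinForm ℝ 𝔤) : ℝ :=
  scalarCurv (fun _ _ _ => 0) (structureConst b) (fun _ => components b A) 0

/-- The trace of a covariant 2-tensor `A` on `𝔤` with respect to the metric `γ`. -/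
def tr (b : Module.Basis (Fin n) ℝ 𝔤) (γ A : LinearMap.BilinForm ℝ 𝔤) : ℝ :=
  metricTrace (components b γ) (components b A)

/-- The length of a covector on `𝔤` with respect to the metric `γ`. -/
def covectorNorm (b : Module.Basis (Fin n) ℝ 𝔤) (γ : LinearMap.BilinForm ℝ 𝔤)
    (j : Module.Dual ℝ 𝔤) : ℝ :=
  √(metricTrace (components b γ) (Matrix.of fun i k => j (b i) * j (b k)))

end LieAlg

/-! ### Spatially homogeneous coupled quintessence models -/

/-- The data of a spatially homogeneous model on `M = G × I`, where `𝔤` is the Lie algebra of `G`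
and `I = [t₀, ∞)`. Only the values at times in `I` and at field values in `J` matter. -/
structure Model (𝔤 : Type*) [LieRing 𝔤] [LieAlgebra ℝ 𝔤] where
  /-- initial time -/
  t₀ : ℝ
  /-- range of the scalar field -/
  J : Set ℝ
  /-- potential -/
  V : ℝ → ℝ
  /-- coupling functions -/
  C : ℝ → ℝ
  /-- coupling functions -/
  c : ℝ → ℝ
  /-- scalar field -/
  φ : ℝ → ℝ
  /-- family of left-invariant Riemannian metrics on `G` -/
  γ : ℝ → LinearMap.BilinForm ℝ 𝔤
  /-- energy density of the matter -/
  ρ : ℝ → ℝ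
  /-- flow covector of the matter -/
  j : ℝ → Module.Dual ℝ 𝔤
  /-- pressure tensor of the matter -/
  S : ℝ → LinearMap.BilinForm ℝ 𝔤

namespace Model

variable {𝔤 : Type*} [LieRing 𝔤] [LieAlgebra ℝ 𝔤] {n : ℕ}

/-- The time interval. -/
def I (m : Model 𝔤) : Set ℝ := Ici m.t₀

/-- Time derivative on `I` (one-sided at the initial time). -/
def dot (m : Model 𝔤) (f : ℝ → ℝ) : ℝ → ℝ := derivWithin f m.I

/-- Derivative of the potential on `J`. -/
def V' (m : Model 𝔤) : ℝ → ℝ := derivWithin m.V m.J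

/-- Regularity and algebraic type of the data. -/
structure IsAdmissible (m : Model 𝔤) : Prop where
  ordConnected_J : m.J.OrdConnected
  interior_J : (interior m.J).Nonempty
  contDiff_V : ContDiffOn ℝ 1 m.V m.J
  contDiff_C : ContDiffOn ℝ 1 m.C m.J
  continuous_c : ContinuousOn m.c m.J
  mapsTo_φ : MapsTo m.φ m.I m.J
  contDiff_φ : ContDiffOn ℝ 2 m.φ m.I
  isMetric_γ : ∀ t ∈ m.I, IsMetric (m.γ t)
  contDiff_γ : ∀ X Y, ContDiffOn ℝ 2 (fun t => m.γ t X Y) m.I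
  contDiff_ρ : ContDiffOn ℝ 1 m.ρ m.I
  contDiff_j : ∀ X, ContDiffOn ℝ 1 (fun t => m.j t X) m.I
  contDiff_S : ∀ X Y, ContDiffOn ℝ 1 (fun t => m.S t X Y) m.I
  symm_S : ∀ t ∈ m.I, ∀ X Y, m.S t X Y = m.S t Y X

/-! The space-time `M = G × I` carries the frame `(b_1, …, b_n, ∂_t)`, indexed by
`Fin n ⊕ Unit`. -/

/-- Derivatives of functions of `t` along the frame fields `b_1, …, b_n, ∂_t`. -/
def frameDeriv (m : Model 𝔤) : Fin n ⊕ Unit → (ℝ → ℝ) → ℝ → ℝ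
  | .inl _, _ => fun _ => 0
  | .inr _, f => m.dot f

/-- Structure coefficients of the frame: `[b_i, b_j]` is given by the Lie algebra, and
`[b_i, ∂_t] = 0`. -/
def frameBracket (b : Module.Basis (Fin n) ℝ 𝔤) :
    Fin n ⊕ Unit → Fin n ⊕ Unit → Fin n ⊕ Unit → ℝ
  | .inl i, .inl j, .inl k => structureConst b i j k
  | _, _, _ => 0

/-- The Lorentzian metric `g = γ - dt ⊗ dt`. -/
def g (m : Model 𝔤) (b : Module.Basis (Fin n) ℝ 𝔤) (t : ℝ) :
    Matrix (Fin n ⊕ Unit) (Fin n ⊕ Unit) ℝ :=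
  Matrix.fromBlocks (components b (m.γ t)) 0 0 (Matrix.of fun _ _ => -1)

/-- The energy-momentum tensor `T = S - j ⊗ dt - dt ⊗ j + ρ dt ⊗ dt`. -/
def T (m : Model 𝔤) (b : Module.Basis (Fin n) ℝ 𝔤) (t : ℝ) :
    Matrix (Fin n ⊕ Unit) (Fin n ⊕ Unit) ℝ :=
  Matrix.fromBlocks (components b (m.S t)) (Matrix.of fun i _ => -m.j t (b i))
    (Matrix.of fun _ i => -m.j t (b i)) (Matrix.of fun _ _ => m.ρ t)

/-- The coupled Einstein-scalar field-matter equations on `M`. -/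
structure SolvesESM (m : Model 𝔤) (b : Module.Basis (Fin n) ℝ 𝔤) : Prop where
  /-- `Rc - (R/2) g = ∇φ ⊗ ∇φ - (1/2) |∇φ|² g - V(φ) g + C(φ) T` -/
  einstein : ∀ t ∈ m.I, ∀ μ ν : Fin n ⊕ Unit,
    ricci m.frameDeriv (frameBracket b) (m.g b) μ ν t
        - (1 / 2) * scalarCurv m.frameDeriv (frameBracket b) (m.g b) t * m.g b t μ ν
      = m.frameDeriv μ m.φ t * m.frameDeriv ν m.φ t
        - (1 / 2) * gradSq m.frameDeriv (m.g b) m.φ t * m.g b t μ ν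
        - m.V (m.φ t) * m.g b t μ ν + m.C (m.φ t) * m.T b t μ ν
  /-- `□φ - V'(φ) = -c(φ) tr T` -/
  scalar : ∀ t ∈ m.I,
    box m.frameDeriv (frameBracket b) (m.g b) m.φ t - m.V' (m.φ t)
      = -(m.c (m.φ t) * metricTrace (m.g b t) (m.T b t))
  /-- `Div (C(φ) T) = c(φ) (tr T) ∇φ` -/
  matter : ∀ t ∈ m.I, ∀ ν : Fin n ⊕ Unit,
    divergence m.frameDeriv (frameBracket b) (m.g b) (fun s => m.C (m.φ s) • m.T b s) ν t
      = m.c (m.φ t) * metricTrace (m.g b t) (m.T b t) * m.frameDeriv ν m.φ t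

/-- The tensor `k = -(1/2) dγ/dt`, in components. -/
def k (m : Model 𝔤) (b : Module.Basis (Fin n) ℝ 𝔤) (t : ℝ) : Matrix (Fin n) (Fin n) ℝ :=
  Matrix.of fun i j => -(1 / 2) * m.dot (fun s => m.γ s (b i) (b j)) t

/-- The negative `H = -tr_γ k / n` of the mean curvature. -/
def H (m : Model 𝔤) (b : Module.Basis (Fin n) ℝ 𝔤) (t : ℝ) : ℝ :=
  -metricTrace (components b (m.γ t)) (m.k b t) / n

/-- The deceleration parameter `q = -1 - (dH/dt) / H²`. -/
def q (m : Model 𝔤) (b : Module.Basis (Fin n) ℝ 𝔤) (t : ℝ) : ℝ :=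
  -1 - m.dot (m.H b) t / m.H b t ^ 2

/-- The conditions that the dominant and the strong energy condition impose on the matter. -/
structure EnergyConditions (m : Model 𝔤) (b : Module.Basis (Fin n) ℝ 𝔤) : Prop where
  dec_flow : ∀ t ∈ m.I, covectorNorm b (m.γ t) (m.j t) ≤ m.ρ t
  dec_pressure : ∀ t ∈ m.I, |tr b (m.γ t) (m.S t)| ≤ n * m.ρ t
  sec : ∀ t ∈ m.I, 0 ≤ m.ρ t + tr b (m.γ t) (m.S t)

/-- The assumptions on the coupling functions. -/
structure CouplingConditions (m : Model 𝔤) : Prop where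
  nonneg : ∀ x ∈ m.J, 0 ≤ m.C x
  bound : ∃ C₀ : ℝ, ∀ x ∈ m.J, |m.c x| ≤ C₀ * m.C x

/-- The assumptions on the potential. -/
structure PotentialConditions (m : Model 𝔤) : Prop where
  pos : ∀ x ∈ m.J, 0 < m.V x
  /-- positive lower semi-continuous minorant on the closure of `J` in `ℝ` -/
  minorant : ∃ W : ℝ → ℝ, LowerSemicontinuousOn W (closure m.J) ∧
    (∀ x ∈ closure m.J, 0 < W x) ∧ ∀ x ∈ m.J, W x ≤ m.V x
  /-- `V'` is bounded where `V` is -/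
  bounded : ∀ A ⊆ m.J, Bornology.IsBounded (m.V '' A) → Bornology.IsBounded (m.V' '' A)
  /-- `V'` extends continuously, with values in `[-∞, ∞]`, to the closure of `J` in `[-∞, ∞]` -/
  extends_closure : ∃ F : EReal → EReal,
    ContinuousOn F (closure ((fun x : ℝ => (x : EReal)) '' m.J)) ∧
      ∀ x ∈ m.J, F (x : EReal) = (m.V' x : EReal)

/-- The infimum `V₀` of the potential energy density along the evolution. -/
def V₀ (m : Model 𝔤) : ℝ := sInf ((fun t => m.V (m.φ t)) '' m.I)

/-- `H₀ = √(2 V₀ / (n (n - 1)))`. -/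
def H₀ (m : Model 𝔤) (n : ℕ) : ℝ := √(2 * m.V₀ / ((n : ℝ) * ((n : ℝ) - 1)))

end Model

end CoupledQuintessence

end

/-! Write `p` for the velocity of the field and `Q = n(n-1)H² - 2V - p²`. The Einstein equations
reduce to the Hamiltonian constraint (`hamiltonian_constraint`) and the Raychaudhuri equation
(`raychaudhuri`). In the constraint `Q` is a sum of shear, minus spatial scalar curvature, and
matter energy; each is nonnegative by Cauchy-Schwarz, the assumption on the group, and the energy
conditions. Hence `Q` is nonnegative and dominates the matter, and Raychaudhuri gives `p² + Q/n ≤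
-(n-1)Ḣ ≤ p² + Q` (`hubble_bounds`).

Since `Q ≥ 0` and `V ≥ V₀ > 0`, `H` can never cross zero and stays above `H₀`. It decreases, so it
converges, and `-Ḣ` has finite integral; therefore `p²` and `Q` do too. The rest is analysis
(`tendsto_of_scalar_field`). The energy `p²/2 + V` changes by friction, which has a sign, and by
coupling, which is bounded by a multiple of `Q`; so it converges. Then `Q` converges, and being
integrable it tends to zero. The acceleration is bounded, so `p⁴` converges and likewise tends to
zero. The constraint now yields the limit of `V`.

It remains to see that the force vanishes (`tendsto_force_zero`). The acceleration is minus the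
force up to a vanishing error. Along a subsequence with nonzero limiting force, the force would keep
its sign on unit time intervals, because the field hardly moves there, and the velocity could not
tend to zero. -/

noncomputable section

namespace CoupledQuintessence

/-! ### Linear algebra: derivative of the inverse, traces, Cauchy-Schwarz. -/

section MatrixLemmas

variable {ι : Type*} [Fintype ι] [DecidableEq ι]

attribute [local instance] Matrix.linftyOpNormedRing Matrix.linftyOpNormedAlgebra in
/-- The derivative of the inverse of a matrix-valued function, in components. -/
theorem hasDerivWithinAt_matrix_inv {A : ℝ → Matrix ι ι ℝ} {A' : Matrix ι ι ℝ} {s : Set ℝ} {t : ℝ}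
    (hA : ∀ i j, HasDerivWithinAt (fun u => A u i j) (A' i j) s t) (hdet : IsUnit (A t).det)
    (i j : ι) :
    HasDerivWithinAt (fun u => (A u)⁻¹ i j) ((-((A t)⁻¹ * A' * (A t)⁻¹)) i j) s t := by
  -- Differentiation is componentwise in `ι → ι → ℝ`, while the derivative of inversion lives in the
  -- normed ring of matrices. The topologies agree, so derivatives pass from one to the other, here
  -- and in `h4`.
  have hA' : HasDerivWithinAt (F := ι → ι → ℝ) (fun u => A u) A' s t :=
    hasDerivWithinAt_pi.2 fun i => hasDerivWithinAt_pi.2 fun j => hA i j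
  obtain ⟨u, hu⟩ := (Matrix.isUnit_iff_isUnit_det _).2 hdet
  have h1 := hasFDerivAt_ringInverse (𝕜 := ℝ) u
  rw [hu] at h1
  have h2 := h1.comp_hasDerivWithinAt t hA'
  have e : (-((ContinuousLinearMap.mulLeftRight ℝ (Matrix ι ι ℝ)) ↑u⁻¹) ↑u⁻¹) A'
      = -((A t)⁻¹ * A' * (A t)⁻¹) := by
    rw [← hu, ← Matrix.coe_units_inv]
    rfl
  have e' : Ring.inverse ∘ A = fun v => (A v)⁻¹ := by
    funext v
    simp only [Function.comp_apply, Matrix.nonsing_inv_eq_ringInverse]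
  have h3 : HasDerivWithinAt (fun v => (A v)⁻¹) (-((A t)⁻¹ * A' * (A t)⁻¹)) s t := by
    rw [← e, ← e']
    exact h2
  have h4 : HasDerivWithinAt (F := ι → ι → ℝ) (fun v => ((A v)⁻¹ : Matrix ι ι ℝ))
    (-((A t)⁻¹ * A' * (A t)⁻¹) : Matrix ι ι ℝ) s t := h3
  exact hasDerivWithinAt_pi.1 (hasDerivWithinAt_pi.1 h4 i) j

/-- Symmetry of `g` is what matches the two index orders; `A` may be arbitrary. -/
theorem metricTrace_eq_trace {g : Matrix ι ι ℝ} (hg : g.IsSymm) (A : Matrix ι ι ℝ) :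
    metricTrace g A = (g⁻¹ * A).trace := by
  have hi : g⁻¹.IsSymm := by rw [Matrix.IsSymm, Matrix.transpose_nonsing_inv, hg.eq]
  simp only [metricTrace, Matrix.trace, Matrix.diag, Matrix.mul_apply]
  rw [Finset.sum_comm]
  exact Finset.sum_congr rfl fun a _ => Finset.sum_congr rfl fun b _ => by rw [hi.apply]

-- With `P = BᴴB`, cyclicity turns the trace into the squared Frobenius norm of `B σ Bᴴ`.
open scoped MatrixOrder in
theorem trace_sq_nonneg {P σ : Matrix ι ι ℝ} (hP : P.PosSemidef) (hσ : σ.IsSymm) :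
    0 ≤ (P * σ * (P * σ)).trace := by
  obtain ⟨B, rfl⟩ := CStarAlgebra.nonneg_iff_eq_star_mul_self.1 hP.nonneg
  rw [Matrix.star_eq_conjTranspose]
  have h : (B.conjTranspose * B * σ * (B.conjTranspose * B * σ)).trace
      = ((B * σ * B.conjTranspose).conjTranspose * (B * σ * B.conjTranspose)).trace := by
    have hs : σ.conjTranspose = σ := by
      rw [Matrix.conjTranspose_eq_transpose_of_trivial]; exact hσ
    simp only [Matrix.conjTranspose_mul, Matrix.conjTranspose_conjTranspose, hs, ← Matrix.mul_assoc]
    rw [Matrix.trace_mul_comm (B * σ * B.conjTranspose * B * σ)]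
    simp only [← Matrix.mul_assoc]
  rw [h]
  exact (Matrix.posSemidef_conjTranspose_mul_self _).trace_nonneg

/-- The Cauchy-Schwarz inequality `(tr_γ k)² ≤ n |k|²_γ`. -/
theorem trace_sq_le {P σ : Matrix ι ι ℝ} (hP : P.PosDef) (hσ : σ.IsSymm) :
    (P * σ).trace ^ 2 ≤ Fintype.card ι * (P * σ * (P * σ)).trace := by
  rcases isEmpty_or_nonempty ι with hι | hι
  · simp [Matrix.trace]
  have hc : (0 : ℝ) < Fintype.card ι := by exact_mod_cast Fintype.card_pos
  -- Subtracting `τ P⁻¹` leaves the trace-free part of `σ` (the shear), whose squared norm is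
  -- nonnegative.
  set τ := (P * σ).trace / Fintype.card ι with hτ
  have hPi : P⁻¹.IsSymm := by
    have := hP.inv.isHermitian
    rwa [Matrix.IsHermitian, Matrix.conjTranspose_eq_transpose_of_trivial] at this
  have hs : (σ - τ • P⁻¹).IsSymm := hσ.sub (hPi.smul τ)
  have h := trace_sq_nonneg hP.posSemidef hs
  have e : P * (σ - τ • P⁻¹) = P * σ - τ • 1 := by
    rw [mul_sub, mul_smul_comm, Matrix.mul_nonsing_inv _ ((Matrix.isUnit_iff_isUnit_det _).1 hP.isUnit)]
  rw [e] at h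
  simp only [mul_sub, sub_mul, smul_mul_assoc, mul_smul_comm, one_mul, mul_one,
    Matrix.trace_sub, Matrix.trace_smul, Matrix.trace_one, smul_eq_mul] at h
  have h2 : (P * σ).trace = Fintype.card ι * τ := by rw [hτ]; field_simp
  rw [h2] at h ⊢
  nlinarith

end MatrixLemmas

/-! ### Geometry of `γ - dt ⊗ dt` in the left-invariant frame. -/

section Geometry

variable {𝔤 : Type*} [LieRing 𝔤] [LieAlgebra ℝ 𝔤] {n : ℕ}

theorem posDef_components (b : Module.Basis (Fin n) ℝ 𝔤) {A : LinearMap.BilinForm ℝ 𝔤}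
    (hA : IsMetric A) : (components b A).PosDef := by
  refine Matrix.PosDef.of_dotProduct_mulVec_pos ?_ fun x hx => ?_
  · ext i j
    simp [components, hA.1 (b j) (b i)]
  · have hX : ∑ i, x i • b i ≠ 0 := fun h => hx (funext fun i =>
      Fintype.linearIndependent_iff.1 b.linearIndependent x h i)
    have h := hA.2 _ hX
    simpa [components, dotProduct, Matrix.mulVec, Finset.mul_sum, mul_comm, mul_left_comm,
      LinearMap.sum_apply, map_sum, hA.1] using h

theorem isUnit_det_components (b : Module.Basis (Fin n) ℝ 𝔤) {A : LinearMap.BilinForm ℝ 𝔤}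
    (hA : IsMetric A) : IsUnit (components b A).det :=
  (Matrix.isUnit_iff_isUnit_det _).1 (posDef_components b hA).isUnit

theorem isSymm_components (b : Module.Basis (Fin n) ℝ 𝔤) {A : LinearMap.BilinForm ℝ 𝔤}
    (hA : ∀ X Y, A X Y = A Y X) : (components b A).IsSymm := by
  ext i j
  simp [components, hA (b j) (b i)]

namespace Model

variable (m : Model 𝔤) (b : Module.Basis (Fin n) ℝ 𝔤)

theorem isSymm_k {t : ℝ} (hm : m.IsAdmissible) (ht : t ∈ m.I) : (m.k b t).IsSymm := by
  ext i j
  simp only [k, Matrix.transpose_apply, Matrix.of_apply, dot]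
  rw [derivWithin_congr (fun s hs => (hm.isMetric_γ s hs).1 (b j) (b i))
    ((hm.isMetric_γ t ht).1 (b j) (b i))]

theorem inv_g {t : ℝ} (h : IsUnit (components b (m.γ t)).det) :
    (m.g b t)⁻¹ = Matrix.fromBlocks (components b (m.γ t))⁻¹ 0 0 (Matrix.of fun _ _ => -1) := by
  apply Matrix.inv_eq_right_inv
  rw [g, Matrix.fromBlocks_multiply, Matrix.mul_nonsing_inv _ h]
  have : (Matrix.of fun _ _ => (-1 : ℝ) : Matrix Unit Unit ℝ) * (Matrix.of fun _ _ => -1) = 1 := by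
    ext; simp [Matrix.mul_apply]
  simp [this]

/-- Traces with respect to `g = γ - dt ⊗ dt`. -/
theorem metricTrace_g {t : ℝ} (h : IsUnit (components b (m.γ t)).det)
    (A : Matrix (Fin n ⊕ Unit) (Fin n ⊕ Unit) ℝ) :
    metricTrace (m.g b t) A
      = metricTrace (components b (m.γ t)) A.toBlocks₁₁ - A (.inr ()) (.inr ()) := by
  simp [metricTrace, inv_g m b h, Fintype.sum_sum_type, Matrix.toBlocks₁₁, sub_eq_add_neg]

@[simp] theorem dot_const (x t : ℝ) : m.dot (fun _ => x) t = 0 := by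
  simp [dot]

/-- Connection coefficients of the left-invariant metric `γ t` on the group. -/
def spatialChristoffel (t : ℝ) (i j l : Fin n) : ℝ :=
  christoffel (fun _ _ _ => 0) (structureConst b) (fun _ => components b (m.γ t)) i j l 0

/-- The second fundamental form as an endomorphism. -/
def shape (t : ℝ) : Matrix (Fin n) (Fin n) ℝ := (components b (m.γ t))⁻¹ * m.k b t

/-! ### Connection coefficients of the space-time metric. -/

section Christoffel

variable {m b} {t : ℝ}

theorem christoffel_inl_inl_inl (h : IsUnit (components b (m.γ t)).det) (i j l : Fin n) :
    christoffel m.frameDeriv (frameBracket b) (m.g b) (.inl i) (.inl j) (.inl l) t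
      = m.spatialChristoffel b t i j l := by
  simp only [spatialChristoffel, christoffel, inv_g m b h]
  simp [koszul, Fintype.sum_sum_type, frameDeriv,
    frameBracket, g]

theorem christoffel_inl_inl_inr (h : IsUnit (components b (m.γ t)).det) (i j : Fin n) :
    christoffel m.frameDeriv (frameBracket b) (m.g b) (.inl i) (.inl j) (.inr ()) t
      = -m.k b t i j := by
  simp only [christoffel, inv_g m b h]
  simp [koszul, Fintype.sum_sum_type, frameDeriv,
    frameBracket, g, k, components]

/-- The coefficient is half of `γ⁻¹` applied to the time derivative `-2k`. Symmetry of `k` puts its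
indices in the order used by `shape`. -/
theorem christoffel_inl_inr_inl (h : IsUnit (components b (m.γ t)).det)
    (hk : (m.k b t).IsSymm) (i j : Fin n) :
    christoffel m.frameDeriv (frameBracket b) (m.g b) (.inl i) (.inr ()) (.inl j) t
      = -m.shape b t j i := by
  have hk' : ∀ l, m.k b t l i = m.k b t i l := fun l => hk.apply i l
  simp only [shape, Matrix.mul_apply, hk']
  simp only [christoffel, inv_g m b h]
  simp [koszul, Fintype.sum_sum_type, frameDeriv,
    frameBracket, g, k, components]

theorem christoffel_inr_inl_inl (h : IsUnit (components b (m.γ t)).det)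
    (hk : (m.k b t).IsSymm) (i j : Fin n) :
    christoffel m.frameDeriv (frameBracket b) (m.g b) (.inr ()) (.inl i) (.inl j) t
      = -m.shape b t j i := by
  have hk' : ∀ l, m.k b t l i = m.k b t i l := fun l => hk.apply i l
  simp only [shape, Matrix.mul_apply, hk']
  simp only [christoffel, inv_g m b h]
  simp [koszul, Fintype.sum_sum_type, frameDeriv,
    frameBracket, g, k, components]

theorem christoffel_inl_inr_inr (h : IsUnit (components b (m.γ t)).det) (i : Fin n) :
    christoffel m.frameDeriv (frameBracket b) (m.g b) (.inl i) (.inr ()) (.inr ()) t = 0 := by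
  simp only [christoffel, inv_g m b h]
  simp [koszul, Fintype.sum_sum_type, frameDeriv, frameBracket, g]

theorem christoffel_inr_inl_inr (h : IsUnit (components b (m.γ t)).det) (i : Fin n) :
    christoffel m.frameDeriv (frameBracket b) (m.g b) (.inr ()) (.inl i) (.inr ()) t = 0 := by
  simp only [christoffel, inv_g m b h]
  simp [koszul, Fintype.sum_sum_type, frameDeriv, frameBracket, g]

theorem christoffel_inr_inr (μ : Fin n ⊕ Unit) :
    christoffel m.frameDeriv (frameBracket b) (m.g b) (.inr ()) (.inr ()) μ t = 0 := by
  simp [christoffel, koszul, Fintype.sum_sum_type, frameDeriv, frameBracket, g]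

theorem dot_congr {f₁ f₂ : ℝ → ℝ} (ht : t ∈ m.I) (h : ∀ s ∈ m.I, f₁ s = f₂ s) :
    m.dot f₁ t = m.dot f₂ t :=
  derivWithin_congr h (h t ht)

end Christoffel

/-! ### Ricci curvature of the space-time in terms of `γ` and `k`. -/

section Ricci

variable {m b} {t : ℝ}

theorem hasDerivWithinAt_γ (hm : m.IsAdmissible) (ht : t ∈ m.I) (i j : Fin n) :
    HasDerivWithinAt (fun s => components b (m.γ s) i j) (((-2 : ℝ) • m.k b t) i j) m.I t := by
  have h := ((hm.contDiff_γ (b i) (b j)).differentiableOn two_ne_zero t ht).hasDerivWithinAt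
  simpa [components, k, dot, I] using h

theorem hasDerivWithinAt_k (hm : m.IsAdmissible) (ht : t ∈ m.I) (i j : Fin n) :
    HasDerivWithinAt (fun s => m.k b s i j) (m.dot (fun s => m.k b s i j) t) m.I t := by
  have h := ((hm.contDiff_γ (b i) (b j)).derivWithin (uniqueDiffOn_Ici _) (m := 1) (by norm_num)
    ).differentiableOn one_ne_zero t ht
  exact (h.const_mul (-(1 / 2))).hasDerivWithinAt

/-- The derivative of the second fundamental form as an endomorphism. -/
theorem hasDerivWithinAt_shape (hm : m.IsAdmissible) (ht : t ∈ m.I) (i j : Fin n) :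
    HasDerivWithinAt (fun s => m.shape b s i j)
      (((2 : ℝ) • (m.shape b t * m.shape b t) + (components b (m.γ t))⁻¹ *
        Matrix.of fun i j => m.dot (fun s => m.k b s i j) t) i j) m.I t := by
  have h1 := hasDerivWithinAt_matrix_inv (fun i j => hasDerivWithinAt_γ (b := b) hm ht i j)
    (isUnit_det_components b (hm.isMetric_γ t ht))
  have h2 := HasDerivWithinAt.fun_sum (u := Finset.univ) fun l _ =>
    (h1 i l).mul (hasDerivWithinAt_k (b := b) hm ht l j)
  -- As `γ` has derivative `-2k`, its inverse has derivative `2 γ⁻¹ k γ⁻¹`.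
  have e : -((components b (m.γ t))⁻¹ * ((-2 : ℝ) • m.k b t) * (components b (m.γ t))⁻¹)
      = (2 : ℝ) • (m.shape b t * (components b (m.γ t))⁻¹) := by
    simp [shape, neg_smul]
  rw [e] at h2
  refine h2.congr_deriv ?_
  rw [Finset.sum_add_distrib, Matrix.add_apply]
  congr 1
  rw [← Matrix.mul_apply]
  simp [shape, Matrix.mul_assoc]

theorem hasDerivWithinAt_trace_shape (hm : m.IsAdmissible) (ht : t ∈ m.I) :
    HasDerivWithinAt (fun s => (m.shape b s).trace)
      (2 * (m.shape b t * m.shape b t).trace + ((components b (m.γ t))⁻¹ *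
        Matrix.of fun i j => m.dot (fun s => m.k b s i j) t).trace) m.I t := by
  have h := HasDerivWithinAt.fun_sum (u := Finset.univ) fun i _ =>
    hasDerivWithinAt_shape (b := b) hm ht i i
  refine h.congr_deriv ?_
  simp [Matrix.trace, Finset.sum_add_distrib, Finset.mul_sum]

theorem isUnit_det (hm : m.IsAdmissible) (ht : t ∈ m.I) : IsUnit (components b (m.γ t)).det :=
  isUnit_det_components b (hm.isMetric_γ t ht)

/-- `Rc(∂_t, ∂_t)`. -/
theorem ricci_inr_inr (hm : m.IsAdmissible) (ht : t ∈ m.I) :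
    ricci m.frameDeriv (frameBracket b) (m.g b) (.inr ()) (.inr ()) t
      = m.dot (fun s => (m.shape b s).trace) t - (m.shape b t * m.shape b t).trace := by
  have hu := isUnit_det (b := b) hm ht
  have hk := isSymm_k m b hm ht
  have hd : m.dot (fun s => (m.shape b s).trace) t = ∑ i, m.dot (fun s => m.shape b s i i) t := by
    refine HasDerivWithinAt.derivWithin ?_ (uniqueDiffOn_Ici _ t ht)
    exact HasDerivWithinAt.fun_sum fun i _ =>
      (hasDerivWithinAt_shape hm ht i i).differentiableWithinAt.hasDerivWithinAt
  have hdi : ∀ i, m.dot (christoffel m.frameDeriv (frameBracket b) (m.g b)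
      (.inl i) (.inr ()) (.inl i)) t = -m.dot (fun s => m.shape b s i i) t := fun i => by
    rw [dot_congr ht fun s hs => christoffel_inl_inr_inl (isUnit_det hm hs) (isSymm_k m b hm hs) i i]
    exact derivWithin.fun_neg
  rw [hd]
  simp [ricci, riemann, Fintype.sum_sum_type, christoffel_inr_inr,
    christoffel_inl_inr_inl hu hk, christoffel_inr_inl_inl hu hk, frameDeriv, frameBracket, hdi,
    Finset.sum_add_distrib, Matrix.trace, Matrix.mul_apply, mul_comm,
    sub_eq_add_neg]

/-- The spatial components of the Ricci tensor of `g`. -/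
theorem ricci_inl_inl (hm : m.IsAdmissible) (ht : t ∈ m.I) (i j : Fin n) :
    ricci m.frameDeriv (frameBracket b) (m.g b) (.inl i) (.inl j) t
      = ricci (fun _ _ _ => 0) (structureConst b) (fun _ => components b (m.γ t)) i j 0
        + m.k b t i j * (m.shape b t).trace - 2 * (m.k b t * m.shape b t) i j
        - m.dot (fun s => m.k b s i j) t := by
  have hu := isUnit_det (b := b) hm ht
  have hk := isSymm_k m b hm ht
  have hdi : m.dot (christoffel m.frameDeriv (frameBracket b) (m.g b)
      (.inl i) (.inl j) (.inr ())) t = -m.dot (fun s => m.k b s i j) t := by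
    rw [dot_congr ht fun s hs => christoffel_inl_inl_inr (isUnit_det hm hs) i j]
    exact derivWithin.fun_neg
  -- This is the symmetry of `k γ⁻¹ k`.
  have hkk : ∑ x, m.k b t x j * m.shape b t x i = ∑ x, m.k b t i x * m.shape b t x j := by
    have h : ((m.k b t).transpose * m.shape b t).transpose = m.k b t * m.shape b t := by
      have hi : (components b (m.γ t))⁻¹.transpose = (components b (m.γ t))⁻¹ := by
        rw [Matrix.transpose_nonsing_inv, isSymm_components b (hm.isMetric_γ t ht).1]
      simp only [shape, Matrix.transpose_mul, hi, hk.eq,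
        Matrix.mul_assoc]
    simpa [Matrix.mul_apply] using congrFun (congrFun h i) j
  have hkk' : ∑ x, m.shape b t x j * m.k b t i x = ∑ x, m.k b t i x * m.shape b t x j :=
    Finset.sum_congr rfl fun _ _ => mul_comm _ _
  have hs : ∀ i j l, christoffel (fun _ _ _ => 0) (structureConst b)
      (fun _ => components b (m.γ t)) i j l 0 = m.spatialChristoffel b t i j l := fun _ _ _ => rfl
  simp only [ricci, riemann, Fintype.sum_sum_type, christoffel_inr_inr,
    christoffel_inl_inr_inr hu, christoffel_inl_inl_inl hu, christoffel_inl_inl_inr hu,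
    christoffel_inr_inl_inr hu, hs,
    christoffel_inl_inr_inl hu hk, christoffel_inr_inl_inl hu hk, frameDeriv, frameBracket, hdi,
    Finset.sum_add_distrib, Finset.sum_sub_distrib, Matrix.trace, Matrix.mul_apply, Matrix.diag,
    Finset.univ_unique, Finset.sum_singleton, Finset.mul_sum, neg_mul_neg, mul_zero, zero_mul,
    sub_zero, add_zero, zero_add, Finset.sum_const_zero, PUnit.default_eq_unit, hkk, hkk']
  simp only [← Finset.mul_sum]
  ring

end Ricci
end Model
end Geometry

/-! ### Asymptotic analysis on a half-line. -/

section Asymptotics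

theorem monotoneOn_of_hasDerivWithinAt {t₀ : ℝ} {f f' : ℝ → ℝ}
    (hf : ∀ t ∈ Ici t₀, HasDerivWithinAt f (f' t) (Ici t₀) t) (h : ∀ t ∈ Ici t₀, 0 ≤ f' t) :
    MonotoneOn f (Ici t₀) := by
  refine monotoneOn_of_hasDerivWithinAt_nonneg (convex_Ici t₀)
    (fun t ht => (hf t ht).continuousWithinAt) (f' := f') ?_ ?_
  · exact fun t ht => (hf t (interior_subset ht)).mono interior_subset
  · exact fun t ht => h t (interior_subset ht)

theorem antitoneOn_of_hasDerivWithinAt {t₀ : ℝ} {f f' : ℝ → ℝ}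
    (hf : ∀ t ∈ Ici t₀, HasDerivWithinAt f (f' t) (Ici t₀) t) (h : ∀ t ∈ Ici t₀, f' t ≤ 0) :
    AntitoneOn f (Ici t₀) := by
  have := monotoneOn_of_hasDerivWithinAt (fun t ht => (hf t ht).neg)
    (fun t ht => neg_nonneg.2 (h t ht))
  intro a ha b hb hab
  simpa using this ha hb hab

theorem exists_tendsto_of_antitoneOn {t₀ B : ℝ} {f : ℝ → ℝ} (hf : AntitoneOn f (Ici t₀))
    (hB : ∀ t ∈ Ici t₀, B ≤ f t) : ∃ L, Tendsto f atTop (𝓝 L) := by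
  -- Truncating the argument at `t₀` gives a function that is antitone on all of `ℝ`.
  have ha : Antitone fun t => f (max t₀ t) := fun a b hab =>
    hf (mem_Ici.2 (le_max_left _ _)) (mem_Ici.2 (le_max_left _ _)) (max_le_max le_rfl hab)
  refine ⟨_, (tendsto_atTop_ciInf ha ⟨B, ?_⟩).congr' ?_⟩
  · rintro _ ⟨t, rfl⟩
    exact hB _ (mem_Ici.2 (le_max_left _ _))
  · filter_upwards [eventually_ge_atTop t₀] with t ht
    simp [max_eq_right ht]

/-- A function that is bounded below converges if its derivative is bounded above by a multiple of
`-h`, where `h` is the derivative of a convergent function. -/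
theorem exists_tendsto_of_deriv_le {t₀ B K L : ℝ} {f f' H h : ℝ → ℝ}
    (hf : ∀ t ∈ Ici t₀, HasDerivWithinAt f (f' t) (Ici t₀) t) (hB : ∀ t ∈ Ici t₀, B ≤ f t)
    (hH : ∀ t ∈ Ici t₀, HasDerivWithinAt H (h t) (Ici t₀) t) (hK : 0 ≤ K)
    (hH0 : ∀ t ∈ Ici t₀, 0 ≤ H t) (hL : Tendsto H atTop (𝓝 L))
    (hle : ∀ t ∈ Ici t₀, f' t ≤ -K * h t) : ∃ M, Tendsto f atTop (𝓝 M) := by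
  -- Adding `K H` absorbs the possible growth of `f`: the sum decreases and is bounded below.
  have hd : ∀ t ∈ Ici t₀, HasDerivWithinAt (fun t => f t + K * H t) (f' t + K * h t) (Ici t₀) t :=
    fun t ht => (hf t ht).add ((hH t ht).const_mul K)
  obtain ⟨M, hM⟩ := exists_tendsto_of_antitoneOn (B := B)
    (antitoneOn_of_hasDerivWithinAt hd fun t ht => by linarith [hle t ht])
    (fun t ht => by nlinarith [hB t ht, hH0 t ht])
  refine ⟨M - K * L, (hM.sub (hL.const_mul K)).congr fun t => ?_⟩
  ring

/-- A nonnegative convergent function that is bounded by a multiple of `-h`, where `h` is the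
derivative of a convergent function, tends to zero. -/
theorem tendsto_zero_of_le_deriv {t₀ K L M : ℝ} {f H h : ℝ → ℝ}
    (hf0 : ∀ t ∈ Ici t₀, 0 ≤ f t)
    (hH : ∀ t ∈ Ici t₀, HasDerivWithinAt H (h t) (Ici t₀) t)
    (hL : Tendsto H atTop (𝓝 L)) (hle : ∀ t ∈ Ici t₀, f t ≤ -K * h t)
    (hM : Tendsto f atTop (𝓝 M)) : Tendsto f atTop (𝓝 0) := by
  have hM0 : 0 ≤ M := ge_of_tendsto hM (by
    filter_upwards [eventually_ge_atTop t₀] with t ht using hf0 t ht)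
  rcases hM0.eq_or_lt with h0 | hpos
  · rwa [h0]
  exfalso
  obtain ⟨T, hT⟩ := eventually_atTop.1 ((hM.eventually (lt_mem_nhds (half_lt_self hpos))).and
    (eventually_ge_atTop t₀))
  -- If `M > 0`, then eventually `K h ≤ -f < -M/2`, so `K H + (M/2) t` decreases; but `H` converges,
  -- so it must tend to infinity.
  have hd : ∀ t ∈ Ici T, HasDerivWithinAt (fun t => K * H t + M / 2 * t)
      (K * h t + M / 2 * 1) (Ici T) t := fun t ht =>
    (((hH t (hT t ht).2).const_mul K).mono (Ici_subset_Ici.2 (hT T le_rfl).2)).add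
      ((hasDerivWithinAt_id t _).const_mul _)
  have ha := antitoneOn_of_hasDerivWithinAt hd fun t ht => by
    have := hle t (hT t ht).2
    have := (hT t ht).1
    linarith
  have htop : Tendsto (fun t => K * H t + M / 2 * t) atTop atTop :=
    (hL.const_mul K).add_atTop (tendsto_id.const_mul_atTop (half_pos hpos))
  obtain ⟨t, ht1, ht2⟩ := ((htop.eventually_gt_atTop (K * H T + M / 2 * T)).and
    (eventually_ge_atTop T)).exists
  exact absurd (ha self_mem_Ici ht2 ht2) (not_le.2 ht1)

/-- If `p` converges then its derivative cannot be bounded away from zero from above on unit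
intervals that go to infinity. -/
theorem not_eventually_deriv_le {t₀ δ : ℝ} {p p' : ℝ → ℝ} {l : Filter ℝ} [l.NeBot]
    (hl : l ≤ atTop) (hp : ∀ t ∈ Ici t₀, HasDerivWithinAt p (p' t) (Ici t₀) t)
    (h0 : Tendsto p atTop (𝓝 0)) (hδ : 0 < δ) :
    ¬ ∀ᶠ t in l, ∀ θ ∈ Icc (0 : ℝ) 1, p' (t + θ) ≤ -δ := by
  intro h
  have h1 : Tendsto (fun t => p (t + 1) - p t) atTop (𝓝 (0 - 0)) :=
    (h0.comp (tendsto_atTop_add_const_right _ _ tendsto_id)).sub h0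
  rw [sub_zero] at h1
  have h2 := hl (h1.eventually (lt_mem_nhds (neg_lt_zero.2 hδ)))
  obtain ⟨t, ⟨ht1, ht2⟩, ht3⟩ := ((h.and h2).and (hl (eventually_ge_atTop t₀))).exists
  have hc : ContinuousOn p (Icc t (t + 1)) := fun s hs =>
    ((hp s (le_trans ht3 hs.1)).continuousWithinAt).mono fun u hu => le_trans ht3 hu.1
  obtain ⟨s, hs, hs'⟩ := exists_hasDerivAt_eq_slope p p' (by linarith : t < t + 1) hc
    fun s hs => (hp s (le_trans ht3 hs.1.le)).hasDerivAt (Ici_mem_nhds (lt_of_le_of_lt ht3 hs.1))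
  have := ht1 (s - t) ⟨by linarith [hs.1], by linarith [hs.2]⟩
  have e : t + (s - t) = s := by ring
  rw [e, hs'] at this
  have e2 : t + 1 - t = 1 := by ring
  rw [e2, div_one] at this
  linarith

/-- If `φ` has derivative `p → 0` and `p' + F(φ) → 0`, where `F` is a continuous function on a
closed subset of `[-∞, ∞]`, then `F(φ) → 0`. -/
theorem tendsto_force_zero {t₀ : ℝ} {φ p p' v : ℝ → ℝ} {F : EReal → EReal} {s : Set EReal}
    (hs : IsClosed s) (hF : ContinuousOn F s)
    (hφs : ∀ t ∈ Ici t₀, (φ t : EReal) ∈ s) (hFv : ∀ t ∈ Ici t₀, F (φ t) = (v t : EReal))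
    (hφ : ∀ t ∈ Ici t₀, HasDerivWithinAt φ (p t) (Ici t₀) t)
    (hp : ∀ t ∈ Ici t₀, HasDerivWithinAt p (p' t) (Ici t₀) t)
    (hp0 : Tendsto p atTop (𝓝 0)) (hpv : Tendsto (fun t => p' t + v t) atTop (𝓝 0)) :
    Tendsto v atTop (𝓝 0) := by
  rw [tendsto_iff_ultrafilter]
  intro U hU
  -- Compactness of `[-∞, ∞]` gives a limit of `φ` along each ultrafilter, even if `φ` is unbounded.
  obtain ⟨x, -, hx⟩ := isCompact_univ.ultrafilter_le_nhds
    (U.map fun t => (φ t : EReal)) (by simp)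
  have hx : Tendsto (fun t => (φ t : EReal)) U (𝓝 x) := hx
  have hxs : x ∈ s := hs.mem_of_tendsto hx (hU (by
    filter_upwards [eventually_ge_atTop t₀] with t ht using hφs t ht))
  -- The product with a principal filter expresses uniformity in `θ ∈ [0, 1]`.
  have hshift : Tendsto (fun z : ℝ × ℝ => z.1 + z.2) ((U : Filter ℝ) ×ˢ 𝓟 (Icc (0 : ℝ) 1))
      atTop := by
    refine tendsto_atTop_mono' _ ?_ ((tendsto_id.mono_left hU).comp tendsto_fst)
    rw [EventuallyLE, eventually_prod_principal_iff]
    exact Eventually.of_forall fun t θ hθ => by simpa using hθ.1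
  have hdiff : Tendsto (fun z : ℝ × ℝ => φ (z.1 + z.2) - φ z.1)
      ((U : Filter ℝ) ×ˢ 𝓟 (Icc (0 : ℝ) 1)) (𝓝 0) := by
    rw [Metric.tendsto_nhds]
    intro ε hε
    rw [eventually_prod_principal_iff]
    obtain ⟨T, hT⟩ := eventually_atTop.1
      ((Metric.tendsto_nhds.1 hp0 (ε / 2) (half_pos hε)).and (eventually_ge_atTop t₀))
    filter_upwards [hU (eventually_ge_atTop T)] with t ht θ hθ
    have hT0 := (hT T le_rfl).2
    have := (convex_Ici T).norm_image_sub_le_of_norm_hasDerivWithin_le (f := φ) (f' := p)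
      (C := ε / 2) (x := t) (y := t + θ)
      (fun u hu => (hφ u (hT u hu).2).mono (Ici_subset_Ici.2 hT0))
      (fun u hu => by simpa using (hT u hu).1.le) ht (le_trans ht (by simpa using hθ.1))
    rw [dist_zero_right]
    refine this.trans_lt ?_
    have : ‖t + θ - t‖ ≤ 1 := by
      rw [add_sub_cancel_left, Real.norm_of_nonneg hθ.1]; exact hθ.2
    nlinarith
  have hxu : Tendsto (fun z : ℝ × ℝ => (φ (z.1 + z.2) : EReal))
      ((U : Filter ℝ) ×ˢ 𝓟 (Icc (0 : ℝ) 1)) (𝓝 x) := by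
    have h1 : Tendsto (fun z : ℝ × ℝ => ((φ (z.1 + z.2) - φ z.1 : ℝ) : EReal))
      ((U : Filter ℝ) ×ˢ 𝓟 (Icc (0 : ℝ) 1)) (𝓝 ((0 : ℝ) : EReal)) := by
      exact EReal.tendsto_coe.2 hdiff
    -- Addition is continuous at `(x, 0)` even for infinite `x`, because the second summand is
    -- finite.
    have h2 := (EReal.continuousAt_add (p := (x, ((0 : ℝ) : EReal))) (Or.inr (by simp))
      (Or.inr (by simp))).tendsto.comp ((hx.comp tendsto_fst).prodMk_nhds h1)
    have e : x + ((0 : ℝ) : EReal) = x := by simp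
    simp only [e] at h2
    refine h2.congr fun z => ?_
    simp only [Function.comp]
    rw [← EReal.coe_add]
    congr 1
    ring
  have hFx : Tendsto (fun z : ℝ × ℝ => (v (z.1 + z.2) : EReal))
      ((U : Filter ℝ) ×ˢ 𝓟 (Icc (0 : ℝ) 1)) (𝓝 (F x)) := by
    have hev := hshift.eventually (eventually_ge_atTop t₀)
    have h1 := (hF x hxs).tendsto.comp (tendsto_nhdsWithin_iff.2
      ⟨hxu, hev.mono fun z hz => hφs _ hz⟩)
    exact h1.congr' (hev.mono fun z hz => hFv _ hz)
  have hF0 : F x = 0 := by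
    have hpvu := hpv.comp hshift
    by_contra hne
    rcases lt_or_gt_of_ne hne with hlt | hgt
    -- A real `δ` strictly between `F x` and `0` also covers an infinite `F x`. On the windows `v <
    -- δ` and `p' + v > δ/2`, hence `p' > -δ/2 > 0`.
    · obtain ⟨δ, hδ1, hδ2⟩ := EReal.lt_iff_exists_real_btwn.1 hlt
      have hδ2 : δ < 0 := by exact_mod_cast hδ2
      refine not_eventually_deriv_le (δ := -δ / 2) hU (fun t ht => (hp t ht).neg)
        (neg_zero (G := ℝ) ▸ hp0.neg) (by linarith) ?_
      have h1 := hFx.eventually (gt_mem_nhds hδ1)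
      have h2 := hpvu.eventually (lt_mem_nhds (by linarith : δ / 2 < 0))
      have h3 := h1.and h2
      rw [eventually_prod_principal_iff] at h3
      filter_upwards [h3] with t ht θ hθ
      obtain ⟨ha, hb⟩ := ht θ hθ
      have ha : v (t + θ) < δ := by exact_mod_cast ha
      simp only [Function.comp] at hb
      linarith
    · obtain ⟨δ, hδ1, hδ2⟩ := EReal.lt_iff_exists_real_btwn.1 hgt
      have hδ1 : 0 < δ := by exact_mod_cast hδ1
      refine not_eventually_deriv_le (δ := δ / 2) hU hp hp0 (by linarith) ?_
      have h1 := hFx.eventually (lt_mem_nhds hδ2)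
      have h2 := hpvu.eventually (gt_mem_nhds (by linarith : 0 < δ / 2))
      have h3 := h1.and h2
      rw [eventually_prod_principal_iff] at h3
      filter_upwards [h3] with t ht θ hθ
      obtain ⟨ha, hb⟩ := ht θ hθ
      have ha : δ < v (t + θ) := by exact_mod_cast ha
      simp only [Function.comp] at hb
      linarith
  rw [← EReal.tendsto_coe]
  have h1 : Tendsto (fun t : ℝ => (t, (0 : ℝ))) U ((U : Filter ℝ) ×ˢ 𝓟 (Icc (0 : ℝ) 1)) :=
    tendsto_id.prodMk (tendsto_principal.2 (Eventually.of_forall fun _ => by simp))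
  simpa [hF0, Function.comp_def] using hFx.comp h1

/-- Late-time behaviour of a scalar field `φ` with velocity `p`, force `-v` and potential energy
`U`, in a universe with Hubble function `H`; `h` is the derivative of `H`, and `e` is the source
term in the equation for `φ`. -/
theorem tendsto_of_scalar_field {t₀ N K : ℝ} (hN : 1 < N) (hK : 0 ≤ K)
    {H h φ p p' U v e : ℝ → ℝ}
    (hH : ∀ t ∈ Ici t₀, HasDerivWithinAt H (h t) (Ici t₀) t)
    (hφ : ∀ t ∈ Ici t₀, HasDerivWithinAt φ (p t) (Ici t₀) t)
    (hp : ∀ t ∈ Ici t₀, HasDerivWithinAt p (p' t) (Ici t₀) t)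
    (hU : ∀ t ∈ Ici t₀, HasDerivWithinAt U (v t * p t) (Ici t₀) t)
    (hH0 : ∀ t ∈ Ici t₀, 0 < H t) (hU0 : ∀ t ∈ Ici t₀, 0 < U t)
    (hfield : ∀ t ∈ Ici t₀, p' t = -N * H t * p t - v t + e t)
    (hQ : ∀ t ∈ Ici t₀, 0 ≤ N * (N - 1) * H t ^ 2 - 2 * U t - p t ^ 2)
    (hle : ∀ t ∈ Ici t₀, p t ^ 2 + (N * (N - 1) * H t ^ 2 - 2 * U t - p t ^ 2) / N
      ≤ -(N - 1) * h t)
    (hge : ∀ t ∈ Ici t₀, -(N - 1) * h t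
      ≤ p t ^ 2 + (N * (N - 1) * H t ^ 2 - 2 * U t - p t ^ 2))
    (he : ∀ t ∈ Ici t₀, |e t| ≤ K * (N * (N - 1) * H t ^ 2 - 2 * U t - p t ^ 2))
    (hv : ∀ A, (∀ t ∈ Ici t₀, U t ≤ A) → ∃ B, ∀ t ∈ Ici t₀, |v t| ≤ B)
    {F : EReal → EReal} {s : Set EReal} (hs : IsClosed s) (hF : ContinuousOn F s)
    (hφs : ∀ t ∈ Ici t₀, (φ t : EReal) ∈ s) (hFv : ∀ t ∈ Ici t₀, F (φ t) = (v t : EReal)) :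
    ∃ L, Tendsto H atTop (𝓝 L) ∧ Tendsto U atTop (𝓝 (1 / 2 * N * (N - 1) * L ^ 2)) ∧
      Tendsto v atTop (𝓝 0) ∧ Tendsto p atTop (𝓝 0) ∧ Tendsto p' atTop (𝓝 0) ∧
      Tendsto h atTop (𝓝 0) := by
  set Q : ℝ → ℝ := fun t => N * (N - 1) * H t ^ 2 - 2 * U t - p t ^ 2 with hQdef
  have hN0 : 0 < N := by linarith
  have hN1 : 0 < N - 1 := by linarith
  have hNN : 0 < N * (N - 1) := mul_pos hN0 hN1
  have hge' : ∀ᶠ t in atTop, t ∈ Ici t₀ := eventually_ge_atTop t₀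
  have hQ' : ∀ t ∈ Ici t₀, 0 ≤ Q t := hQ
  have hph : ∀ t ∈ Ici t₀, p t ^ 2 ≤ -(N - 1) * h t := fun t ht => by
    have := div_nonneg (hQ' t ht) hN0.le
    have : p t ^ 2 + Q t / N ≤ -(N - 1) * h t := hle t ht
    linarith
  have hQh : ∀ t ∈ Ici t₀, Q t ≤ -(N * (N - 1)) * h t := fun t ht => by
    have h1 : p t ^ 2 + Q t / N ≤ -(N - 1) * h t := hle t ht
    have h2 : Q t / N ≤ -(N - 1) * h t := by linarith [sq_nonneg (p t)]
    rw [div_le_iff₀ hN0] at h2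
    linarith
  have hanti := antitoneOn_of_hasDerivWithinAt hH fun t ht => by
    have := (sq_nonneg (p t)).trans (hph t ht)
    nlinarith
  obtain ⟨L, hL⟩ := exists_tendsto_of_antitoneOn hanti (fun t ht => (hH0 t ht).le)
  set A := H t₀ with hA
  have hHA : ∀ t ∈ Ici t₀, H t ≤ A := fun t ht => hanti self_mem_Ici ht ht
  -- The summand `1` ensures `P ≤ P²`, so that one constant bounds `Q`, `U` and `|p|`.
  set P := N * (N - 1) * A ^ 2 + 1 with hP
  have hHP : ∀ t ∈ Ici t₀, N * (N - 1) * H t ^ 2 ≤ P := fun t ht => by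
    have h1 : H t ^ 2 ≤ A ^ 2 := pow_le_pow_left₀ (hH0 t ht).le (hHA t ht) 2
    nlinarith
  have hP1 : 1 ≤ P := by
    have := mul_nonneg hNN.le (sq_nonneg A)
    linarith
  have hA0 : 0 < A := hH0 t₀ self_mem_Ici
  have hQP : ∀ t ∈ Ici t₀, Q t ≤ P := fun t ht => by
    have := hHP t ht
    have := hU0 t ht
    simp only [hQdef]
    nlinarith [sq_nonneg (p t)]
  have hpP : ∀ t ∈ Ici t₀, |p t| ≤ P := fun t ht => by
    have h1 := hQ t ht
    have h2 := hHP t ht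
    have h3 := hU0 t ht
    refine abs_le_of_sq_le_sq ?_ (by linarith)
    nlinarith
  obtain ⟨B, hB⟩ := hv P fun t ht => by
    have h1 := hQ t ht
    have h2 := hHP t ht
    have h3 := hU0 t ht
    nlinarith [sq_nonneg (p t)]
  have hB0 : 0 ≤ B := (abs_nonneg _).trans (hB t₀ self_mem_Ici)
  have he' : ∀ t ∈ Ici t₀, |e t| ≤ K * Q t := he
  -- the energy of the scalar field converges
  have hW : ∀ t ∈ Ici t₀, HasDerivWithinAt (fun t => p t ^ 2 / 2 + U t)
      (p t * p' t + v t * p t) (Ici t₀) t := fun t ht => by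
    refine ((((hp t ht).pow 2).div_const 2).add (hU t ht)).congr_deriv ?_
    push_cast
    ring
  obtain ⟨W, hWlim⟩ := exists_tendsto_of_deriv_le (B := 0) (K := P * (K * (N * (N - 1)))) hW
    (fun t ht => by have := hU0 t ht; positivity) hH (by positivity)
    (fun t ht => (hH0 t ht).le) hL fun t ht => by
      have h1 : p t * p' t + v t * p t = -(N * H t * p t ^ 2) + p t * e t := by
        rw [hfield t ht]; ring
      have h2 : p t * e t ≤ P * (K * (-(N * (N - 1)) * h t)) := by
        calc p t * e t ≤ |p t| * |e t| := by rw [← abs_mul]; exact le_abs_self _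
          _ ≤ P * (K * (-(N * (N - 1)) * h t)) :=
            mul_le_mul (hpP t ht) ((he' t ht).trans (mul_le_mul_of_nonneg_left (hQh t ht) hK))
              (abs_nonneg _) (by linarith)
      have h3 : 0 ≤ N * H t * p t ^ 2 := by have := hH0 t ht; positivity
      rw [h1]
      linarith
  have hQlim : Tendsto Q atTop (𝓝 0) := by
    -- `Q` equals `N(N-1)H²` minus twice the energy, hence it converges.
    refine tendsto_zero_of_le_deriv hQ' hH hL hQh
      (M := N * (N - 1) * L ^ 2 - 2 * W) ?_
    refine (((hL.pow 2).const_mul (N * (N - 1))).sub (hWlim.const_mul 2)).congr fun t => ?_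
    simp only [hQdef]
    ring
  have helim : Tendsto e atTop (𝓝 0) := by
    have h1 := hQlim.const_mul K
    rw [mul_zero] at h1
    exact squeeze_zero_norm' (hge'.mono fun t ht => he' t ht) h1
  -- the velocity tends to zero
  set D := N * A * P + B + K * P with hD
  have hD0 : 0 ≤ D := by positivity
  have hp'D : ∀ t ∈ Ici t₀, |p' t| ≤ D := fun t ht => by
    rw [hfield t ht]
    have h1 : |-N * H t * p t| ≤ N * A * P := by
      rw [abs_mul, abs_mul, abs_neg, abs_of_pos hN0, abs_of_pos (hH0 t ht)]
      exact mul_le_mul (mul_le_mul_of_nonneg_left (hHA t ht) hN0.le) (hpP t ht) (abs_nonneg _)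
        (by positivity)
    have h2 := (he' t ht).trans (mul_le_mul_of_nonneg_left (hQP t ht) hK)
    have h3 := hB t ht
    have h4 := abs_add_le (-N * H t * p t - v t) (e t)
    have h5 := abs_sub (-N * H t * p t) (v t)
    linarith
  -- The derivative of `p²` is only known to be bounded by a multiple of `|p|`. That of `p⁴` keeps a
  -- factor `p²`, which `-h` controls.
  have hp4 : ∀ t ∈ Ici t₀, HasDerivWithinAt (fun t => p t ^ 4) (4 * p t ^ 3 * p' t) (Ici t₀) t :=
    fun t ht => ((hp t ht).pow 4).congr_deriv (by push_cast; ring)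
  obtain ⟨M, hM⟩ := exists_tendsto_of_deriv_le (B := 0) (K := 4 * (P * D) * (N - 1)) hp4
    (fun t _ => by positivity) hH (by positivity) (fun t ht => (hH0 t ht).le) hL fun t ht => by
      have h1 : p t * p' t ≤ P * D := by
        calc p t * p' t ≤ |p t| * |p' t| := by rw [← abs_mul]; exact le_abs_self _
          _ ≤ P * D := mul_le_mul (hpP t ht) (hp'D t ht) (abs_nonneg _) (by linarith)
      have hPD : 0 ≤ P * D := by positivity
      calc 4 * p t ^ 3 * p' t = 4 * (p t ^ 2 * (p t * p' t)) := by ring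
        _ ≤ 4 * (p t ^ 2 * (P * D)) := by gcongr
        _ ≤ 4 * ((-(N - 1) * h t) * (P * D)) := by
          have := hph t ht
          gcongr
        _ = _ := by ring
  have hp4lim : Tendsto (fun t => p t ^ 4) atTop (𝓝 0) :=
    tendsto_zero_of_le_deriv (K := P ^ 2 * (N - 1)) (fun t _ => by positivity) hH hL
      (fun t ht => by
        have h1 : p t ^ 2 ≤ P ^ 2 := by
          rw [← sq_abs]; exact pow_le_pow_left₀ (abs_nonneg _) (hpP t ht) 2
        calc p t ^ 4 = p t ^ 2 * p t ^ 2 := by ring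
          _ ≤ P ^ 2 * (-(N - 1) * h t) :=
            mul_le_mul h1 (hph t ht) (sq_nonneg _) (sq_nonneg _)
          _ = _ := by ring) hM
  have hplim : Tendsto p atTop (𝓝 0) := by
    rw [tendsto_zero_iff_abs_tendsto_zero]
    have h1 := (hp4lim.sqrt).sqrt
    simp only [Real.sqrt_zero] at h1
    refine h1.congr fun t => ?_
    rw [show p t ^ 4 = (p t ^ 2) ^ 2 by ring, Real.sqrt_sq (sq_nonneg _), Real.sqrt_sq_eq_abs]
    rfl
  have hHp : Tendsto (fun t => -N * H t * p t + e t) atTop (𝓝 0) := by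
    simpa using ((hL.const_mul (-N)).mul hplim).add helim
  have hvlim : Tendsto v atTop (𝓝 0) :=
    tendsto_force_zero hs hF hφs hFv hφ hp hplim (hHp.congr' (hge'.mono fun t ht => by
      simp only [hfield t ht]; ring))
  refine ⟨L, hL, ?_, hvlim, hplim, ?_, ?_⟩
  · have h1 := ((((hL.pow 2).const_mul (N * (N - 1))).sub hQlim).sub (hplim.pow 2)).div_const 2
    have h2 : (N * (N - 1) * L ^ 2 - 0 - 0 ^ 2) / 2 = 1 / 2 * N * (N - 1) * L ^ 2 := by ring
    rw [h2] at h1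
    refine h1.congr fun t => ?_
    simp only [hQdef]
    ring
  · have h1 := hHp.sub hvlim
    rw [sub_zero] at h1
    exact h1.congr' (hge'.mono fun t ht => by simp only [hfield t ht]; ring)
  · have h1 := ((hplim.pow 2).add hQlim).div_const (N - 1)
    have h2 : ((0 : ℝ) ^ 2 + 0) / (N - 1) = 0 := by simp
    rw [h2] at h1
    refine squeeze_zero_norm' (hge'.mono fun t ht => ?_) h1
    have h3 : -(N - 1) * h t ≤ p t ^ 2 + Q t := hge t ht
    have h4 := (sq_nonneg (p t)).trans (hph t ht)
    have h5 : h t ≤ 0 := by nlinarith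
    rw [Real.norm_eq_abs, abs_of_nonpos h5, le_div_iff₀ hN1]
    linarith

end Asymptotics

/-! ### Reduction of the field equations to ordinary differential equations. -/

section FieldEquations

variable {𝔤 : Type*} [LieRing 𝔤] [LieAlgebra ℝ 𝔤] {n : ℕ}

namespace Model

variable {m : Model 𝔤} {b : Module.Basis (Fin n) ℝ 𝔤} {t : ℝ}

/-- The trace of the spatial components of the Ricci tensor of `g`. -/
theorem metricTrace_ricci (hm : m.IsAdmissible) (ht : t ∈ m.I) :
    metricTrace (components b (m.γ t)) (Matrix.of fun i j =>
        ricci m.frameDeriv (frameBracket b) (m.g b) (.inl i) (.inl j) t)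
      = leftInvScalarCurv b (m.γ t) + (m.shape b t).trace ^ 2
        - m.dot (fun s => (m.shape b s).trace) t := by
  have hs := isSymm_components b (hm.isMetric_γ t ht).1
  -- The derivative of `γ⁻¹` inside the trace contributes `2 tr(shape²)`, which cancels the
  -- quadratic term of the spatial Ricci tensor.
  have hd : m.dot (fun s => (m.shape b s).trace) t = _ :=
    (hasDerivWithinAt_trace_shape (b := b) hm ht).derivWithin (uniqueDiffOn_Ici _ t ht)
  have e : (Matrix.of fun i j =>
      ricci m.frameDeriv (frameBracket b) (m.g b) (.inl i) (.inl j) t)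
      = (Matrix.of fun i j => ricci (fun _ _ _ => 0) (structureConst b)
          (fun _ => components b (m.γ t)) i j 0)
        + (m.shape b t).trace • m.k b t - (2 : ℝ) • (m.k b t * m.shape b t)
        - Matrix.of fun i j => m.dot (fun s => m.k b s i j) t := by
    ext i j
    simp [ricci_inl_inl hm ht, mul_comm]
  rw [hd, e, metricTrace_eq_trace hs, leftInvScalarCurv, scalarCurv, metricTrace_eq_trace hs]
  simp only [mul_sub, mul_add, Matrix.trace_sub, Matrix.trace_add, Matrix.mul_smul,
    Matrix.trace_smul, smul_eq_mul, ← Matrix.mul_assoc]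
  rw [← shape]
  ring

theorem scalarCurv_g (hm : m.IsAdmissible) (ht : t ∈ m.I) :
    scalarCurv m.frameDeriv (frameBracket b) (m.g b) t
      = metricTrace (components b (m.γ t)) (Matrix.of fun i j =>
        ricci m.frameDeriv (frameBracket b) (m.g b) (.inl i) (.inl j) t)
        - ricci m.frameDeriv (frameBracket b) (m.g b) (.inr ()) (.inr ()) t := by
  rw [scalarCurv, metricTrace_g m b (isUnit_det hm ht)]
  rfl

theorem gradSq_g (hm : m.IsAdmissible) (ht : t ∈ m.I) :
    gradSq m.frameDeriv (m.g b) m.φ t = -m.dot m.φ t ^ 2 := by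
  rw [gradSq, metricTrace_g m b (isUnit_det hm ht)]
  simp [Matrix.toBlocks₁₁, frameDeriv, metricTrace, sq]

theorem metricTrace_T (hm : m.IsAdmissible) (ht : t ∈ m.I) :
    metricTrace (m.g b t) (m.T b t) = tr b (m.γ t) (m.S t) - m.ρ t := by
  rw [metricTrace_g m b (isUnit_det hm ht)]
  simp [T, tr]

theorem H_eq (hm : m.IsAdmissible) (ht : t ∈ m.I) :
    m.H b t = -(m.shape b t).trace / n := by
  rw [H, metricTrace_eq_trace (isSymm_components b (hm.isMetric_γ t ht).1), shape]

theorem box_g (hm : m.IsAdmissible) (ht : t ∈ m.I) :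
    box m.frameDeriv (frameBracket b) (m.g b) m.φ t
      = (m.shape b t).trace * m.dot m.φ t - m.dot (m.dot m.φ) t := by
  have hu := isUnit_det (b := b) hm ht
  have e : (Matrix.of fun i j : Fin n => m.k b t i j * m.dot m.φ t)
      = m.dot m.φ t • m.k b t := by
    ext; simp [mul_comm]
  rw [box, metricTrace_g m b hu]
  simp only [Matrix.toBlocks₁₁, Matrix.of_apply, Fintype.sum_sum_type, frameDeriv,
    christoffel_inl_inl_inr hu, christoffel_inr_inr, mul_zero, zero_mul, zero_sub, zero_add,
    Finset.univ_unique, Finset.sum_singleton, Finset.sum_const_zero, PUnit.default_eq_unit,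
    sub_zero, neg_mul, neg_neg]
  rw [e, metricTrace_eq_trace (isSymm_components b (hm.isMetric_γ t ht).1), Matrix.mul_smul,
    Matrix.trace_smul, smul_eq_mul, shape, mul_comm]

theorem scalar_eq (hm : m.IsAdmissible) (hESM : m.SolvesESM b) (hn : n ≠ 0) (ht : t ∈ m.I) :
    m.dot (m.dot m.φ) t = -n * m.H b t * m.dot m.φ t - m.V' (m.φ t)
      + m.c (m.φ t) * (tr b (m.γ t) (m.S t) - m.ρ t) := by
  have h := hESM.scalar t ht
  have hn' : (n : ℝ) ≠ 0 := Nat.cast_ne_zero.2 hn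
  rw [box_g hm ht, metricTrace_T hm ht] at h
  have h2 : (m.shape b t).trace = -n * m.H b t := by
    rw [H_eq hm ht]; field_simp
  rw [← h2]
  linarith

/-- The Hamiltonian constraint. -/
theorem hamiltonian_constraint (hm : m.IsAdmissible) (hESM : m.SolvesESM b) (ht : t ∈ m.I) :
    leftInvScalarCurv b (m.γ t) + (m.shape b t).trace ^ 2 - (m.shape b t * m.shape b t).trace
      = m.dot m.φ t ^ 2 + 2 * m.V (m.φ t) + 2 * (m.C (m.φ t) * m.ρ t) := by
  have h := hESM.einstein t ht (.inr ()) (.inr ())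
  rw [scalarCurv_g hm ht, metricTrace_ricci hm ht, ricci_inr_inr hm ht, gradSq_g hm ht] at h
  simp only [frameDeriv, g, T, Matrix.fromBlocks_apply₂₂, Matrix.of_apply] at h
  linarith

/-- The Raychaudhuri equation. -/
theorem raychaudhuri (hm : m.IsAdmissible) (hESM : m.SolvesESM b) (ht : t ∈ m.I) :
    (n - 1) * m.dot (fun s => (m.shape b s).trace) t
      = (n - 1) * (m.shape b t * m.shape b t).trace + (n - 1) * m.dot m.φ t ^ 2
        - 2 * m.V (m.φ t)
        + m.C (m.φ t) * ((n - 2) * m.ρ t + tr b (m.γ t) (m.S t)) := by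
  have hs := isSymm_components b (hm.isMetric_γ t ht).1
  have hu := isUnit_det (b := b) hm ht
  have e : (Matrix.of fun i j =>
      ricci m.frameDeriv (frameBracket b) (m.g b) (.inl i) (.inl j) t)
      = ((1 / 2) * scalarCurv m.frameDeriv (frameBracket b) (m.g b) t
        + (1 / 2) * m.dot m.φ t ^ 2 - m.V (m.φ t)) • components b (m.γ t)
        + m.C (m.φ t) • components b (m.S t) := by
    ext i j
    have h := hESM.einstein t ht (.inl i) (.inl j)
    rw [gradSq_g hm ht] at h
    simp only [frameDeriv, g, T, Matrix.fromBlocks_apply₁₁] at h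
    simp only [Matrix.of_apply, Matrix.add_apply, Matrix.smul_apply, smul_eq_mul]
    linarith
  have h1 := congrArg (metricTrace (components b (m.γ t))) e
  rw [metricTrace_eq_trace hs (_ + _), mul_add, Matrix.mul_smul, Matrix.mul_smul,
    Matrix.nonsing_inv_mul _ hu, Matrix.trace_add, Matrix.trace_smul, Matrix.trace_smul,
    Matrix.trace_one, ← metricTrace_eq_trace hs, Fintype.card_fin, scalarCurv_g hm ht,
    metricTrace_ricci hm ht, ricci_inr_inr hm ht, smul_eq_mul, smul_eq_mul, ← tr] at h1
  have h2 := hamiltonian_constraint hm hESM ht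
  -- This multiple of the constraint eliminates the spatial scalar curvature.
  linear_combination h1 + (n / 2 - 1 : ℝ) * h2

theorem hasDerivWithinAt_H (hm : m.IsAdmissible) (ht : t ∈ m.I) :
    HasDerivWithinAt (m.H b) (-m.dot (fun s => (m.shape b s).trace) t / n) m.I t := by
  have h := (hasDerivWithinAt_trace_shape (b := b) hm ht).differentiableWithinAt.hasDerivWithinAt
  exact (h.neg.div_const n).congr (fun s hs => H_eq hm hs) (H_eq hm ht)

theorem dot_H (hm : m.IsAdmissible) (ht : t ∈ m.I) :
    m.dot (m.H b) t = -m.dot (fun s => (m.shape b s).trace) t / n :=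
  (hasDerivWithinAt_H hm ht).derivWithin (uniqueDiffOn_Ici _ t ht)

/-- Nonnegativity of the shear. -/
theorem trace_shape_sq_le (hm : m.IsAdmissible) (ht : t ∈ m.I) :
    (m.shape b t).trace ^ 2 ≤ n * (m.shape b t * m.shape b t).trace := by
  have h := trace_sq_le (posDef_components b (hm.isMetric_γ t ht)).inv (isSymm_k m b hm ht)
  rwa [Fintype.card_fin] at h

/-- The bounds for `N = n (n - 1) H² - 2 V(φ) - (dφ/dt)²` and for `dH/dt` that follow from the
constraint, the Raychaudhuri equation, and the energy conditions. -/
theorem hubble_bounds (hn : 3 ≤ n) (hm : m.IsAdmissible) (hESM : m.SolvesESM b)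
    (hT : m.EnergyConditions b) (hC : m.CouplingConditions) (ht : t ∈ m.I)
    (hR : leftInvScalarCurv b (m.γ t) ≤ 0) {N : ℝ}
    (hN : N = n * (n - 1) * m.H b t ^ 2 - 2 * m.V (m.φ t) - m.dot m.φ t ^ 2) :
    0 ≤ m.ρ t ∧ 2 * (m.C (m.φ t) * m.ρ t) ≤ N ∧
      m.dot m.φ t ^ 2 + N / n ≤ -(n - 1) * m.dot (m.H b) t ∧
      -(n - 1) * m.dot (m.H b) t ≤ m.dot m.φ t ^ 2 + N := by
  have hn3 : (3 : ℝ) ≤ n := by exact_mod_cast hn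
  have hn0 : (0 : ℝ) < n := by linarith
  have hρ : 0 ≤ m.ρ t := (Real.sqrt_nonneg _).trans (hT.dec_flow t ht)
  have hC0 := hC.nonneg _ (hm.mapsTo_φ ht)
  have h1 := hamiltonian_constraint hm hESM ht
  have h2 := raychaudhuri hm hESM ht
  have h3 := trace_shape_sq_le (b := b) hm ht
  have h4 := dot_H (b := b) hm ht
  have h5 := H_eq (b := b) hm ht
  have hS1 := mul_nonneg hC0 (hT.sec t ht)
  have hS2 := mul_le_mul_of_nonneg_left ((le_abs_self _).trans (hT.dec_pressure t ht)) hC0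
  have hCρ := mul_nonneg hC0 hρ
  set τ := (m.shape b t).trace
  set κ := (m.shape b t * m.shape b t).trace
  set p := m.dot m.φ t
  set R := leftInvScalarCurv b (m.γ t)
  set y := m.C (m.φ t) * m.ρ t with hy
  set z := m.C (m.φ t) * tr b (m.γ t) (m.S t) with hz
  have hσ : 0 ≤ n * κ - τ ^ 2 := by linarith
  -- Shear, curvature and matter terms of the constraint, each nonnegative.
  have hNn : n * N = (n * κ - τ ^ 2) - n * R + 2 * n * y := by
    rw [hN, h5]
    have : (n : ℝ) * (n * (n - 1) * (-τ / n) ^ 2) = (n - 1) * τ ^ 2 := by field_simp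
    linear_combination this + (n : ℝ) * h1
  have hh : n * (-(n - 1) * m.dot (m.H b) t)
      = (n * κ - τ ^ 2) - R + n * p ^ 2 + n * y + z := by
    rw [h4]
    have : (n : ℝ) * (-(n - 1) * (-m.dot (fun s => (m.shape b s).trace) t / n))
      = (n - 1) * m.dot (fun s => (m.shape b s).trace) t := by field_simp
    linear_combination this + h2 + h1
  have hny : 2 * y ≤ n * y := by nlinarith
  have hnR : n * R ≤ R := by nlinarith
  refine ⟨hρ, ?_, ?_, ?_⟩
  · refine le_of_mul_le_mul_left ?_ hn0
    nlinarith
  · refine le_of_mul_le_mul_left ?_ hn0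
    rw [hh, mul_add, mul_div_cancel₀ _ hn0.ne']
    refine le_of_mul_le_mul_left ?_ hn0
    -- The strong energy condition bounds the pressure from below by `-y`; then `n ≥ 3` gives `2 ≤ n
    -- - 1` in `h7`.
    have hyz : (n - 1) * y ≤ n * y + z := by linarith
    have h6 : n * κ - τ ^ 2 ≤ n * (n * κ - τ ^ 2) := by nlinarith
    have h7 : 2 * n * y ≤ n * ((n - 1) * y) := by nlinarith [mul_nonneg hn0.le hCρ]
    have h8 := mul_le_mul_of_nonneg_left hyz hn0.le
    linarith
  · refine le_of_mul_le_mul_left ?_ hn0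
    nlinarith

end Model
end FieldEquations

end CoupledQuintessence

end

/-! ### The main theorem. -/

theorem mainTheorem3 {n : ℕ} (hn : 3 ≤ n)
    {G : Type*} [TopologicalSpace G] [ChartedSpace (EuclideanSpace ℝ (Fin n)) G] [Group G]
    [LieGroup (𝓡 n) (minSmoothness ℝ 3) G]
    (b : Module.Basis (Fin n) ℝ (GroupLieAlgebra (𝓡 n) G))
    (hG : ∀ A : LinearMap.BilinForm ℝ (GroupLieAlgebra (𝓡 n) G),
      CoupledQuintessence.IsMetric A → CoupledQuintessence.leftInvScalarCurv b A ≤ 0)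
    (m : CoupledQuintessence.Model (GroupLieAlgebra (𝓡 n) G))
    (hm : m.IsAdmissible) (hESM : m.SolvesESM b) (hT : m.EnergyConditions b)
    (hC : m.CouplingConditions) (hV : m.PotentialConditions)
    (hH : 0 < m.H b m.t₀) (hV₀ : 0 < m.V₀) :
    ∃ Hinf Vinf : ℝ,
      Tendsto (m.H b) atTop (𝓝 Hinf) ∧ m.H₀ n ≤ Hinf ∧ 0 < m.H₀ n ∧
      Vinf = 1 / 2 * (n : ℝ) * ((n : ℝ) - 1) * Hinf ^ 2 ∧ 0 < Vinf ∧
      Tendsto (fun t => m.V (m.φ t)) atTop (𝓝 Vinf) ∧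
      Tendsto (fun t => m.V' (m.φ t)) atTop (𝓝 0) ∧
      Tendsto (m.dot m.φ) atTop (𝓝 0) ∧
      Tendsto (m.dot (m.dot m.φ)) atTop (𝓝 0) ∧
      Tendsto (m.q b) atTop (𝓝 (-1)) := by
  open CoupledQuintessence CoupledQuintessence.Model in
  have hn3 : (3 : ℝ) ≤ n := by exact_mod_cast hn
  have hnn : (0 : ℝ) < n * (n - 1) := by nlinarith
  have hbd : ∀ t ∈ m.I, _ := fun t ht =>
    hubble_bounds hn hm hESM hT hC ht (hG _ (hm.isMetric_γ t ht)) rfl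
  have hpos : ∀ t ∈ m.I, 0 < m.V (m.φ t) := fun t ht => hV.pos _ (hm.mapsTo_φ ht)
  have hV₀le : ∀ t ∈ m.I, m.V₀ ≤ m.V (m.φ t) := fun t ht =>
    csInf_le ⟨0, by rintro _ ⟨s, hs, rfl⟩; exact (hpos s hs).le⟩ (mem_image_of_mem _ ht)
  have hH₀ : 0 < m.H₀ n := Real.sqrt_pos.2 (by positivity)
  have hQ : ∀ t ∈ m.I, 0 ≤ n * (n - 1) * m.H b t ^ 2 - 2 * m.V (m.φ t) - m.dot m.φ t ^ 2 :=
    fun t ht => by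
      obtain ⟨h1, h2, -, -⟩ := hbd t ht
      have := mul_nonneg (hC.nonneg _ (hm.mapsTo_φ ht)) h1
      linarith
  have hHsq : ∀ t ∈ m.I, m.H₀ n ^ 2 ≤ m.H b t ^ 2 := fun t ht => by
    rw [H₀, Real.sq_sqrt (by positivity), div_le_iff₀ hnn]
    nlinarith [hQ t ht, hV₀le t ht, sq_nonneg (m.dot m.φ t)]
  have hdH : ∀ t ∈ m.I, HasDerivWithinAt (m.H b) (m.dot (m.H b) t) m.I t := fun t ht =>
    (hasDerivWithinAt_H hm ht).differentiableWithinAt.hasDerivWithinAt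
  have hHpos : ∀ t ∈ m.I, 0 < m.H b t := fun t ht => by
    -- A nonpositive value would force a zero of `H` by continuity, against `H² ≥ H₀² > 0`.
    by_contra! hneg
    obtain ⟨s, hs, hs0⟩ := isPreconnected_Ici.intermediate_value ht
      (self_mem_Ici : m.t₀ ∈ Ici m.t₀) (fun s hs => (hdH s hs).continuousWithinAt)
      ⟨hneg, hH.le⟩
    have := hHsq s hs
    rw [hs0] at this
    nlinarith
  have hHge : ∀ t ∈ m.I, m.H₀ n ≤ m.H b t := fun t ht =>
    (sq_le_sq₀ hH₀.le (hHpos t ht).le).1 (hHsq t ht)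
  have hφ : ∀ t ∈ m.I, HasDerivWithinAt m.φ (m.dot m.φ t) m.I t := fun t ht =>
    (hm.contDiff_φ.differentiableOn two_ne_zero t ht).hasDerivWithinAt
  have hp : ∀ t ∈ m.I, HasDerivWithinAt (m.dot m.φ) (m.dot (m.dot m.φ) t) m.I t := fun t ht =>
    (((hm.contDiff_φ.derivWithin (uniqueDiffOn_Ici _) (m := 1) (by norm_num)).differentiableOn
      one_ne_zero) t ht).hasDerivWithinAt
  have hU : ∀ t ∈ m.I, HasDerivWithinAt (fun t => m.V (m.φ t))
      (m.V' (m.φ t) * m.dot m.φ t) m.I t := fun t ht =>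
    ((hm.contDiff_V.differentiableOn one_ne_zero _ (hm.mapsTo_φ ht)).hasDerivWithinAt).comp t
      (hφ t ht) hm.mapsTo_φ
  obtain ⟨C₀, hC₀⟩ := hC.bound
  obtain ⟨F, hF, hFV⟩ := hV.extends_closure
  obtain ⟨L, hL, hUlim, hvlim, hplim, hp'lim, hhlim⟩ :=
    -- The source is at most `|C₀| C (n + 1) ρ`, since `|tr S - ρ| ≤ (n + 1) ρ`, and `C ρ` is at
    -- most `Q`.
    tendsto_of_scalar_field (N := n) (K := |C₀| * (n + 1)) (by linarith) (by positivity)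
      hdH hφ hp hU hHpos hpos (fun t ht => scalar_eq hm hESM (by omega) ht) hQ
      (fun t ht => (hbd t ht).2.2.1) (fun t ht => (hbd t ht).2.2.2)
      (fun t ht => by
        obtain ⟨h1, h2, -, -⟩ := hbd t ht
        have hC0 := hC.nonneg _ (hm.mapsTo_φ ht)
        have h3 : |m.c (m.φ t)| ≤ |C₀| * m.C (m.φ t) := (hC₀ _ (hm.mapsTo_φ ht)).trans
          (mul_le_mul_of_nonneg_right (le_abs_self _) hC0)
        have h4 : |tr b (m.γ t) (m.S t) - m.ρ t| ≤ (n + 1) * m.ρ t := by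
          have := abs_sub (tr b (m.γ t) (m.S t)) (m.ρ t)
          rw [abs_of_nonneg h1] at this
          linarith [hT.dec_pressure t ht]
        have h5 := mul_nonneg hC0 h1
        calc |m.c (m.φ t) * (tr b (m.γ t) (m.S t) - m.ρ t)|
            ≤ |C₀| * m.C (m.φ t) * ((n + 1) * m.ρ t) := by
              rw [abs_mul]
              exact mul_le_mul h3 h4 (abs_nonneg _) (by positivity)
          _ = |C₀| * (n + 1) * (m.C (m.φ t) * m.ρ t) := by ring
          _ ≤ _ := mul_le_mul_of_nonneg_left (by linarith) (by positivity))
      (fun A hA => by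
        -- (P2) is applied to the set of values of `φ` along the evolution.
        have h1 := hV.bounded (m.φ '' m.I) hm.mapsTo_φ.image_subset
          ((Metric.isBounded_Icc 0 A).subset (by
            rintro _ ⟨_, ⟨t, ht, rfl⟩, rfl⟩
            exact ⟨(hpos t ht).le, hA t ht⟩))
        obtain ⟨B, hB⟩ := h1.exists_norm_le
        exact ⟨B, fun t ht => hB _ (mem_image_of_mem _ (mem_image_of_mem _ ht))⟩)
      isClosed_closure hF
      (fun t ht => subset_closure (mem_image_of_mem _ (hm.mapsTo_φ ht)))
      (fun t ht => hFV _ (hm.mapsTo_φ ht))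
  have hLge : m.H₀ n ≤ L := ge_of_tendsto hL (by
    filter_upwards [eventually_ge_atTop m.t₀] with t ht using hHge t ht)
  have hLpos : 0 < L := hH₀.trans_le hLge
  refine ⟨L, _, hL, hLge, hH₀, rfl, ?_, hUlim, hvlim, hplim, hp'lim, ?_⟩
  · have := mul_pos hnn (pow_pos hLpos 2)
    linarith
  · have := (hhlim.div (hL.pow 2) (by positivity)).const_sub (-1)
    rw [zero_div, sub_zero] at this
    exact this
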